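/- A pseudotopological space is a set with a convergence relation between filters and points such that (i) the principal ultrafilter at $x$ converges to $x$, (ii) every filter finer than a filter converging to $x$ converges to $x$, (iii) the intersection of two filters converging to $x$ converges to $x$, and (iv) a filter converges to $x$ whenever every ultrafilter finer than it converges to $x$. With the maps preserving convergence these spaces form a category $\mathbf{PsTop}$; topological spaces are regarded as objects of it via the usual convergence of filters. A pseudotopological CW complex is a pseudotopological space $Y$ with subspaces $\varnothing=Y_{-1}\subseteq Y_0\subseteq Y_1\subseteq\cdots$ whose direct limit in $\mathbf{PsTop}$ is $Y$, such that for every $n\ge 0$ the inclusion $Y_{n-1}\to Y_n$ is a pushout in $\mathbf{PsTop}$ of $\bigsqcup_{i\in I_n}S^{n-1}\to\bigsqcup_{i\in I_n}D^n$ along some map $\bigsqcup_{i\in I_n}S^{n-1}\to Y_{n-1}$, for some set $I_n$ (where $S^{-1}=\varnothing$ and $D^0$ is a point). Let $\Delta^n=\{t\in\mathbb{R}^{n+1} : t_i\ge 0,\ \sum_i t_i=1\}$ with boundary $\partial\Delta^n=\{t\in\Delta^n : t_i=0\text{ for some }i\}$, and for a simplicial set $X$ let $$|X|_{\mathbf{PsTop}}=\int^{[n]\in\Delta}X_n\cdot\Delta^n=\Big(\bigsqcup_{n\ge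 0}X_n\times\Delta^n\Big)\Big/\big((\alpha^*x,t)\sim(x,\alpha_*t)\big),$$ the coend (a quotient of a coproduct) being formed in $\mathbf{PsTop}$. Write $x\otimes t$ for the class of $(x,t)$, and let $|X|^{(n)}$ be the subspace of all points $x\otimes t$ with $x\in X_k$, $t\in\Delta^k$, $k\le n$ (so $|X|^{(-1)}=\varnothing$). Let $\mathrm{nd}(X_n)$ be the set of nondegenerate $n$-simplices. **Theorem.** For every simplicial set $X$, $|X|_{\mathbf{PsTop}}$ is a pseudotopological CW complex. More precisely: 1. $|X|_{\mathbf{PsTop}}$ has a CW structure whose $n$-skeleton is $|X|^{(n)}$ for every $n$, whose $n$-cells are in bijection with $\mathrm{nd}(X_n)$, and in which, for every $n$, for some homeomorphism $h:D^n\to\Delta^n$ with $h(S^{n-1})=\partial\Delta^n$, the characteristic map of the cell corresponding to $x\in\mathrm{nd}(X_n)$ is $d\mapsto x\otimes h(d)$. 2. For every $n\ge 0$ the square $$\begin{array}{ccc}\bigsqcup_{x\in \mathrm{nd}(X_n)}\partial\Delta^n&\longrightarrow&|X|^{(n-1)}\\ \downarrow&&\downarrow\\ \bigsqcup_{x\in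 \mathrm{nd}(X_n)}\Delta^n&\longrightarrow&|X|^{(n)}\end{array}$$ whose vertical maps are the inclusions and whose horizontal maps send $(x,t)$ to $x\otimes t$ is well defined, and it is a pushout square in $\mathbf{PsTop}$. -/

import Mathlib

open CategoryTheory Limits Opposite Simplicial

universe u v

/-- A pseudotopological space: a set with a convergence relation between filters and points,
such that principal ultrafilters converge to their points, convergence passes to finer filters,
the intersection of two filters converging to a point (the supremum in Mathlib's order of filters)
converges to that point, and a filter converges to a point as soon as all finer ultrafilters do. -/
structure PsTop : Type (u + 1) where
  carrier : Type u
  Conv : Filter carrier → carrier → Prop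
  conv_pure (x : carrier) : Conv (pure x) x
  conv_mono {F G : Filter carrier} {x : carrier} (h : Conv F x) (hle : G ≤ F) : Conv G x
  conv_sup {F G : Filter carrier} {x : carrier} (hF : Conv F x) (hG : Conv G x) : Conv (F ⊔ G) x
  conv_of_ultrafilter {F : Filter carrier} {x : carrier}
    (h : ∀ U : Ultrafilter carrier, (U : Filter carrier) ≤ F → Conv (U : Filter carrier) x) :
    Conv F x

namespace PsTop

theorem exists_ultrafilter_map_eq {A : Type u} {B : Type v} (f : A → B) {F : Filter A}
    {U : Ultrafilter B} (hU : (U : Filter B) ≤ F.map f) :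
    ∃ V : Ultrafilter A, (V : Filter A) ≤ F ∧ V.map f = U := by
  have hne : Filter.NeBot (F ⊓ Filter.comap f (U : Filter B)) := by
    rw [← Filter.map_neBot_iff f, Filter.push_pull, inf_eq_right.2 hU]
    exact U.neBot
  obtain ⟨V, hV⟩ := Ultrafilter.exists_le (F ⊓ Filter.comap f (U : Filter B))
  refine ⟨V, hV.trans inf_le_left, Ultrafilter.coe_le_coe.1 ?_⟩
  rw [Ultrafilter.coe_map]
  exact Filter.map_le_iff_le_comap.2 (hV.trans inf_le_right)

/-- A continuous map of pseudotopological spaces: it preserves convergence of filters. -/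
@[ext]
structure Hom (Y : PsTop.{u}) (Z : PsTop.{v}) : Type (max u v) where
  toFun : Y.carrier → Z.carrier
  cont : ∀ (F : Filter Y.carrier) (y : Y.carrier), Y.Conv F y → Z.Conv (F.map toFun) (toFun y)

/-- The category of pseudotopological spaces and continuous maps. -/
instance category : Category PsTop.{u} where
  Hom Y Z := Hom Y Z
  id Y := ⟨id, fun F y h => by simpa using h⟩
  comp f g := ⟨g.toFun ∘ f.toFun, fun F y h => by
    rw [← Filter.map_map]; exact g.cont _ _ (f.cont _ _ h)⟩

@[ext]
theorem hom_ext {Y Z : PsTop.{u}} {f g : Y ⟶ Z} (h : f.toFun = g.toFun) : f = g :=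
  Hom.ext h

@[simp]
theorem id_toFun (Y : PsTop.{u}) : Hom.toFun (𝟙 Y) = id := rfl

@[simp]
theorem comp_toFun {X Y Z : PsTop.{u}} (f : X ⟶ Y) (g : Y ⟶ Z) :
    Hom.toFun (f ≫ g) = g.toFun ∘ f.toFun := rfl

/-- If the convergence of ultrafilters is prescribed, so is a pseudotopology. -/
def ofUltrafilterConv (A : Type u) (R : Ultrafilter A → A → Prop)
    (hR : ∀ x, R (pure x) x) : PsTop.{u} where
  carrier := A
  Conv F x := ∀ U : Ultrafilter A, (U : Filter A) ≤ F → R U x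
  conv_pure x U hU := by
    have : U = pure x := Ultrafilter.coe_le_coe.1 hU
    exact this ▸ hR x
  conv_mono h hle U hU := h U (hU.trans hle)
  conv_sup hF hG U hU := (Ultrafilter.le_sup_iff.1 hU).elim (hF U) (hG U)
  conv_of_ultrafilter h U hU := h U hU U le_rfl

/-- A topological space as a pseudotopological space. -/
def ofTop (T : Type u) [TopologicalSpace T] : PsTop.{u} where
  carrier := T
  Conv F x := F ≤ nhds x
  conv_pure x := pure_le_nhds x
  conv_mono h hle := hle.trans h
  conv_sup := sup_le
  conv_of_ultrafilter h := Filter.le_iff_ultrafilter.2 h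

/-- A continuous map of topological spaces as a map of pseudotopological spaces. -/
def ofTopMap {S T : Type u} [TopologicalSpace S] [TopologicalSpace T] (f : S → T)
    (hf : Continuous f) : ofTop S ⟶ ofTop T :=
  ⟨f, fun _ y h => (Filter.map_mono h).trans (hf.tendsto y)⟩

/-- The subspace structure (initial with respect to the inclusion) on a subset. -/
def sub (Y : PsTop.{u}) (s : Set Y.carrier) : PsTop.{u} where
  carrier := s
  Conv F x := Y.Conv (F.map Subtype.val) x
  conv_pure x := by simpa using Y.conv_pure x
  conv_mono h hle := Y.conv_mono h (Filter.map_mono hle)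
  conv_sup hF hG := by
    rw [Filter.map_sup]
    exact Y.conv_sup hF hG
  conv_of_ultrafilter {F x} h := by
    refine Y.conv_of_ultrafilter fun U hU => ?_
    obtain ⟨V, hV, rfl⟩ := exists_ultrafilter_map_eq _ hU
    exact h V hV

/-- The inclusion of a subspace into the whole space. -/
def subVal (Y : PsTop.{u}) (s : Set Y.carrier) : sub Y s ⟶ Y :=
  ⟨Subtype.val, fun _ _ h => h⟩

/-- The inclusion of a subspace into a larger one. -/
def subIncl (Y : PsTop.{u}) {s t : Set Y.carrier} (h : s ⊆ t) : sub Y s ⟶ sub Y t :=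
  ⟨Set.inclusion h, fun _ _ hF => hF⟩

/-- The coproduct (disjoint union) of a family of pseudotopological spaces. -/
def sigma {ι : Type v} (Y : ι → PsTop.{u}) : PsTop.{max v u} where
  carrier := Σ i, (Y i).carrier
  Conv F p := ∃ G, (Y p.1).Conv G p.2 ∧ F ≤ G.map (Sigma.mk p.1)
  conv_pure p := ⟨pure p.2, (Y p.1).conv_pure p.2, by simp⟩
  conv_mono h hle := h.imp fun _ hG => ⟨hG.1, hle.trans hG.2⟩
  conv_sup {F F' p} := by
    rintro ⟨G, hG, hF⟩ ⟨G', hG', hF'⟩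
    exact ⟨G ⊔ G', (Y p.1).conv_sup hG hG', by
      rw [Filter.map_sup]; exact sup_le_sup hF hF'⟩
  conv_of_ultrafilter {F p} h := by
    obtain ⟨i, y⟩ := p
    change ∀ U : Ultrafilter (Σ i, (Y i).carrier), (U : Filter (Σ i, (Y i).carrier)) ≤ F →
      ∃ G : Filter (Y i).carrier, (Y i).Conv G y ∧
        (U : Filter (Σ i, (Y i).carrier)) ≤ G.map (Sigma.mk i) at h
    change ∃ G : Filter (Y i).carrier, (Y i).Conv G y ∧ F ≤ G.map (Sigma.mk i)
    have hmem : Set.range (Sigma.mk i) ∈ F := by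
      rw [Filter.mem_iff_ultrafilter]
      intro U hU
      obtain ⟨G, -, hG⟩ := h U hU
      exact hG Filter.range_mem_map
    refine ⟨F.comap (Sigma.mk (β := fun i => (Y i).carrier) i), (Y i).conv_of_ultrafilter fun V hV => ?_, ?_⟩
    · obtain ⟨G, hG, hle⟩ := h (V.map (Sigma.mk i)) (by
        rw [Ultrafilter.coe_map]
        exact Filter.map_le_iff_le_comap.2 hV)
      refine (Y i).conv_mono hG ?_
      rw [Ultrafilter.coe_map] at hle
      exact (Filter.map_le_map_iff (sigma_mk_injective (β := fun i => (Y i).carrier))).1 hle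
    · rw [Filter.map_comap_of_mem hmem]

/-- The canonical map of a summand into the coproduct. -/
def sigmaMk {ι : Type u} (Y : ι → PsTop.{u}) (i : ι) : Y i ⟶ sigma Y :=
  ⟨Sigma.mk (β := fun i => (Y i).carrier) i, fun F _ h =>
    ⟨F, h, le_refl (F.map (Sigma.mk (β := fun i => (Y i).carrier) i))⟩⟩

/-- A map out of a coproduct is continuous if and only if it is so on each summand. -/
theorem continuous_sigma_iff {ι : Type v} {Y : ι → PsTop.{u}} {Z : PsTop.{max v u}}
    (f : (Σ i, (Y i).carrier) → Z.carrier) :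
    (∀ F p, (sigma Y).Conv F p → Z.Conv (F.map f) (f p)) ↔
      ∀ i F y, (Y i).Conv F y → Z.Conv (F.map fun y => f ⟨i, y⟩) (f ⟨i, y⟩) := by
  constructor
  · intro h i F y hF
    exact h (F.map (Sigma.mk i)) ⟨i, y⟩ ⟨F, hF, le_rfl⟩
  · rintro h F ⟨i, y⟩ ⟨G, hG, hle⟩
    refine Z.conv_mono (h i G y hG) ?_
    exact Filter.map_mono (m := f) hle

/-- The copower `I · Y`, i.e. the coproduct of copies of `Y` indexed by the set `I`. -/
def copower (I : Type u) (Y : PsTop.{0}) : PsTop.{u} :=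
  sigma fun _ : I => Y

/-- Functoriality of the copower in both variables. -/
def copowerMap {I J : Type u} (a : I → J) {Y Z : PsTop.{0}} (f : Y ⟶ Z) :
    copower I Y ⟶ copower J Z where
  toFun p := ⟨a p.1, f.toFun p.2⟩
  cont := (continuous_sigma_iff (Z := copower J Z) _).2 fun i F y hF =>
    ⟨F.map f.toFun, f.cont F y hF, by rw [Filter.map_map]; rfl⟩

/-- The quotient of a pseudotopological space by (the equivalence relation generated by) a
relation `r`: an ultrafilter on the quotient converges to a point if and only if it is the image of
an ultrafilter converging to a representative of that point. -/
def quot (Y : PsTop.{u}) (r : Y.carrier → Y.carrier → Prop) : PsTop.{u} :=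
  ofUltrafilterConv (Quot r)
    (fun U q => ∃ (V : Ultrafilter Y.carrier) (y : Y.carrier),
      Y.Conv (V : Filter Y.carrier) y ∧ V.map (Quot.mk r) = U ∧ Quot.mk r y = q)
    (fun q => by
      obtain ⟨y, rfl⟩ := Quot.exists_rep q
      exact ⟨pure y, y, by simpa using Y.conv_pure y, by rw [Ultrafilter.map_pure], rfl⟩)

/-- The quotient map. -/
def quotMk (Y : PsTop.{u}) (r : Y.carrier → Y.carrier → Prop) : Y ⟶ quot Y r where
  toFun := Quot.mk r
  cont F y h U hU := by
    obtain ⟨V, hV, rfl⟩ := exists_ultrafilter_map_eq _ hU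
    exact ⟨V, y, Y.conv_mono h hV, rfl, rfl⟩

/-- The universal property of the quotient. -/
def quotLift {Y Z : PsTop.{u}} {r : Y.carrier → Y.carrier → Prop} (f : Y ⟶ Z)
    (hf : ∀ a b, r a b → f.toFun a = f.toFun b) : quot Y r ⟶ Z where
  toFun := Quot.lift f.toFun hf
  cont F q h := by
    refine Z.conv_of_ultrafilter fun W hW => ?_
    obtain ⟨U, hU, rfl⟩ := exists_ultrafilter_map_eq _ hW
    obtain ⟨V, y, hV, rfl, rfl⟩ := h U hU
    exact f.cont _ _ hV

/-! ### CW complexes -/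

/-- The closed unit disk `D^n` in `ℝ^n`; in particular `D^0` is a point. -/
abbrev Disk (n : ℕ) : Type := Metric.closedBall (0 : EuclideanSpace ℝ (Fin n)) 1

/-- The unit sphere `S^{n-1}` in `ℝ^n`; in particular `S^{-1}` is empty. -/
abbrev BdSphere (n : ℕ) : Type := Metric.sphere (0 : EuclideanSpace ℝ (Fin n)) 1

/-- The inclusion `S^{n-1} → D^n`. -/
def diskIncl (n : ℕ) : ofTop (BdSphere n) ⟶ ofTop (Disk n) :=
  ofTopMap (Set.inclusion Metric.sphere_subset_closedBall) (continuous_inclusion _)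

/-- The diagram of subspaces given by an increasing sequence of subsets. -/
def filtration (Y : PsTop.{u}) (sk : ℕ → Set Y.carrier) (hsk : Monotone sk) :
    ℕ ⥤ PsTop.{u} where
  obj n := sub Y (sk n)
  map f := subIncl Y (hsk (leOfHom f))
  map_id _ := rfl
  map_comp _ _ := rfl

/-- The cocone formed by the inclusions of an increasing sequence of subspaces. -/
def filtrationCocone (Y : PsTop.{u}) (sk : ℕ → Set Y.carrier) (hsk : Monotone sk) :
    Cocone (filtration Y sk hsk) where
  pt := Y
  ι := { app := fun n => subVal Y (sk n), naturality := fun _ _ _ => rfl }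

/-- The structure of a pseudotopological CW complex on `Y`: an increasing sequence of subspaces
`sk 0 = Y_{-1} = ∅ ⊆ sk 1 = Y_0 ⊆ sk 2 = Y_1 ⊆ ...` (so that `sk n` is the `(n-1)`-skeleton),
such that `Y` is their direct limit in `PsTop`, and for each `n` the space
`sk (n + 1)` is obtained from `sk n` by attaching a family of `n`-cells, i.e. there is a pushout
square in `PsTop`
```
  ⨆ S^{n-1} ---> sk n
     |            |
     v            v
  ⨆ D^n -----> sk (n + 1)
```
-/
structure CWStructure (Y : PsTop.{u}) where
  sk : ℕ → Set Y.carrier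
  sk_zero : sk 0 = ∅
  monotone_sk : Monotone sk
  isColimit : Nonempty (IsColimit (filtrationCocone Y sk monotone_sk))
  /-- the index set of the `n`-cells -/
  cells : ℕ → Type u
  /-- the attaching maps of the `n`-cells -/
  attach (n : ℕ) : copower (cells n) (ofTop (BdSphere n)) ⟶ sub Y (sk n)
  /-- the characteristic maps of the `n`-cells -/
  charMap (n : ℕ) : copower (cells n) (ofTop (Disk n)) ⟶ sub Y (sk (n + 1))
  isPushout (n : ℕ) : IsPushout (attach n) (copowerMap id (diskIncl n))
    (subIncl Y (monotone_sk n.le_succ)) (charMap n)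

/-- A pseudotopological CW complex. -/
def IsCWComplex (Y : PsTop.{u}) : Prop := Nonempty (CWStructure Y)

/-! ### Geometric realization -/

/-- The standard simplex `r[n]`, functorially in `[n]`. -/
noncomputable def simplex : SimplexCategory ⥤ PsTop.{0} where
  obj n := ofTop (stdSimplex ℝ (Fin (n.len + 1)))
  map α := ofTopMap (stdSimplex.map α.toOrderHom) (stdSimplex.continuous_map _)
  map_id n := by
    apply hom_ext
    funext t
    change stdSimplex.map (fun i : Fin (n.len + 1) => i) t = t
    exact stdSimplex.map_id_apply t
  map_comp {n m k} α β := by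
    apply hom_ext
    funext t
    exact (stdSimplex.map_comp_apply (S := ℝ) α.toOrderHom β.toOrderHom t).symm

/-- The disjoint union `⨆_n X_n · r[n]`. -/
noncomputable def realizationSum (X : SSet.{u}) : PsTop.{u} :=
  sigma fun n : SimplexCategory => copower (X.obj (op n)) (simplex.obj n)

/-- The point of `⨆_n X_n · r[n]` given by `x ∈ X_n` and `t ∈ r[n]`. -/
def realizationSum.mk (X : SSet.{u}) {n : SimplexCategory} (x : X.obj (op n))
    (t : stdSimplex ℝ (Fin (n.len + 1))) : (realizationSum X).carrier :=
  ⟨n, x, t⟩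

/-- The identifications `(α^* x, t) ∼ (x, α_* t)`, for `α : [n] ⟶ [m]`, `x ∈ X_m`, `t ∈ r[n]`. -/
inductive RealizationRel (X : SSet.{u}) :
    (realizationSum X).carrier → (realizationSum X).carrier → Prop where
  | glue {n m : SimplexCategory} (α : n ⟶ m) (x : X.obj (op m))
      (t : stdSimplex ℝ (Fin (n.len + 1))) :
      RealizationRel X (realizationSum.mk X (X.map α.op x) t)
        (realizationSum.mk X x (stdSimplex.map α.toOrderHom t))

/-- The pseudotopological geometric realization `|X|`: the quotient of `⨆_n X_n · r[n]` in `PsTop`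
by the identifications above. It is the coend of `X_n · r[n]`, see `nonempty_isCoend`. -/
noncomputable def realization (X : SSet.{u}) : PsTop.{u} :=
  quot (realizationSum X) (RealizationRel X)

/-- The point `x ⊗ t` of `|X|` represented by `x ∈ X_n` and `t ∈ r[n]`. -/
noncomputable def tensor (X : SSet.{u}) {n : SimplexCategory} (x : X.obj (op n))
    (t : stdSimplex ℝ (Fin (n.len + 1))) : (realization X).carrier :=
  Quot.mk _ (realizationSum.mk X x t)

/-- The functor `([n], [m]) ↦ X_n · r[m]`. -/
noncomputable def coendFunctor (X : SSet.{u}) :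
    SimplexCategoryᵒᵖ ⥤ SimplexCategory ⥤ PsTop.{u} where
  obj n :=
    { obj := fun m => copower (X.obj n) (simplex.obj m)
      map := fun β => copowerMap id (simplex.map β)
      map_id := fun m => by rw [simplex.map_id]; rfl
      map_comp := fun β γ => by rw [simplex.map_comp]; rfl }
  map α :=
    { app := fun m => copowerMap (X.map α) (𝟙 (simplex.obj m))
      naturality := fun _ _ _ => rfl }
  map_id n := by
    ext m p
    exact congrArg (fun x => (⟨x, p.2⟩ : Σ _ : X.obj n, (simplex.obj m).carrier))
      (congrArg (fun f => f p.1) (X.map_id n))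
  map_comp {n k l} α β := by
    ext m p
    exact congrArg (fun x => (⟨x, p.2⟩ : Σ _ : X.obj l, (simplex.obj m).carrier))
      (congrArg (fun f => f p.1) (X.map_comp α β))

/-- The canonical map `X_n · r[n] ⟶ |X|`. -/
noncomputable def coendι (X : SSet.{u}) (n : SimplexCategory) :
    copower (X.obj (op n)) (simplex.obj n) ⟶ realization X where
  toFun p := tensor X p.1 p.2
  cont F p h := (quotMk (realizationSum X) (RealizationRel X)).cont (F.map (Sigma.mk n)) ⟨n, p⟩
    ⟨F, h, le_rfl⟩

/-- The canonical cowedge on the realization. -/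
noncomputable def realizationCowedge (X : SSet.{u}) : Cowedge (coendFunctor X) :=
  Cowedge.mk (realization X) (coendι X) (by
    intro n m α
    apply hom_ext
    funext p
    exact Quot.sound (RealizationRel.glue α p.1 p.2))

/-- The realization is the coend of `X_n · r[n]` in the category of pseudotopological spaces. -/
theorem nonempty_isCoend (X : SSet.{u}) : Nonempty (IsColimit (realizationCowedge X)) := by
  refine ⟨Multicofork.IsColimit.mk _ (fun E => quotLift (Y := realizationSum X)
    ⟨fun p => (E.π p.1).toFun p.2, ?_⟩ ?_) ?_ ?_⟩
  · exact (continuous_sigma_iff (Z := E.pt) _).2 fun n F y hF => (E.π n).cont F y hF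
  · rintro _ _ ⟨α, x, t⟩
    exact congrFun (congrArg Hom.toFun (Cowedge.condition E α)) ⟨x, t⟩
  · intro E n
    rfl
  · intro E f hf
    apply hom_ext
    funext q
    obtain ⟨⟨n, p⟩, rfl⟩ := Quot.exists_rep q
    exact congrFun (congrArg Hom.toFun (hf n)) p

/-- The `(n-1)`-skeleton `|X|^{(n-1)}` of the realization: the points which can be represented as
`x ⊗ t` with `x ∈ X_k`, `t ∈ r[k]` for some `k ≤ n - 1`, i.e. `k < n` (empty for `n = 0`). -/
def skeleton (X : SSet.{u}) (n : ℕ) : Set (realization X).carrier :=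
  {p | ∃ k : ℕ, k < n ∧ ∃ (x : X.obj (op ⦋k⦌)) (t : stdSimplex ℝ (Fin (k + 1))),
    p = tensor X x t}

theorem monotone_skeleton (X : SSet.{u}) : Monotone (skeleton X) := by
  rintro m n h _ ⟨k, hk, x, t, rfl⟩
  exact ⟨k, hk.trans_le h, x, t, rfl⟩

/-- The boundary `∂r[n]` of the standard simplex, as a subset: the points lying on a facet. -/
def simplexBoundary (n : ℕ) : Set (stdSimplex ℝ (Fin (n + 1))) :=
  {t | ∃ i, t i = 0}

/-- The inclusion `∂r[n] → r[n]`. -/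
def boundaryIncl (n : ℕ) :
    ofTop (simplexBoundary n) ⟶ ofTop (stdSimplex ℝ (Fin (n + 1))) :=
  ofTopMap Subtype.val continuous_subtype_val

end PsTop

/-! Everything rests on a description of convergent ultrafilters (`exists_nonDegenerate_of_conv`).
In a quotient of a coproduct in `PsTop`, a convergent ultrafilter is by construction the image of a
convergent ultrafilter on some x ⊗ Δ^n. Since Δ^n has finitely many faces, that ultrafilter is
carried by the interior of one of them; closed faces being compact and Δ^n Hausdorff, it already
converges in that face. By Eilenberg–Zilber the face of x is a degeneracy of a nondegenerate y, and
degeneracies send interiors to interiors, so y and its simplex may be used instead.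

On points, every element of |X| is y ⊗ s for a unique nondegenerate y and interior s
(`normalForm_tensor`). This bounds the dimension of y when the point lies in a skeleton. Combining
the two, convergence in a skeleton is detected on nondegenerate simplices of admissible dimension
(`continuous_skeleton`), so maps glued from a smaller skeleton and the n-cells are continuous; this
gives the pushouts. The direct limit follows because each convergent ultrafilter comes from a single
simplex, hence from one skeleton. -/

namespace PsTop

/-! ### Maps of standard simplices and supports of their points. -/

section Simplex

variable {ι κ : Type*} [Fintype ι] [Fintype κ]

theorem stdSimplex_map_apply [DecidableEq κ] (f : ι → κ) (t : stdSimplex ℝ ι) (j : κ) :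
    stdSimplex.map f t j = ∑ i with f i = j, t i := by
  rw [stdSimplex.map_coe, FunOnFinite.linearMap_apply_apply]

theorem stdSimplex_map_apply_of_injective {f : ι → κ} (hf : Function.Injective f)
    (t : stdSimplex ℝ ι) (i : ι) : stdSimplex.map f t (f i) = t i := by
  classical
  rw [stdSimplex_map_apply, Finset.sum_eq_single i]
  · intro k hk hki
    exact absurd (hf (by simpa using hk)) hki
  · simp

theorem stdSimplex_map_injective {f : ι → κ} (hf : Function.Injective f) :
    Function.Injective (stdSimplex.map (S := ℝ) f) := by
  intro s t h
  ext i
  rw [← stdSimplex_map_apply_of_injective hf s i, h, stdSimplex_map_apply_of_injective hf]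

/-- Barycentric coordinates are nonnegative, so the sum over a fibre vanishes only if all its terms
do. -/
theorem support_stdSimplex_map (f : ι → κ) (t : stdSimplex ℝ ι) :
    Function.support (stdSimplex.map f t) = f '' Function.support t := by
  classical
  ext j
  rw [Function.mem_support, stdSimplex_map_apply, Ne,
    Finset.sum_eq_zero_iff_of_nonneg fun i _ => stdSimplex.zero_le t i]
  simp [and_comm]

theorem exists_eq_stdSimplex_map {f : ι → κ} (hf : Function.Injective f) {t : stdSimplex ℝ κ}
    (ht : Function.support t ⊆ Set.range f) : ∃ s, stdSimplex.map f s = t := by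
  classical
  have hsum : ∑ i, t (f i) = 1 := by
    rw [← stdSimplex.sum_eq_one t, ← Finset.sum_image (f := t) (g := f) fun _ _ _ _ h => hf h]
    refine Finset.sum_subset (Finset.subset_univ _) fun j _ hj => ?_
    by_contra h
    obtain ⟨i, rfl⟩ := ht h
    simp at hj
  -- Restricting the coordinates along `f` loses no mass, since `t` vanishes off the range.
  refine ⟨⟨fun i => t (f i), fun i => stdSimplex.zero_le t _, hsum⟩, ?_⟩
  ext j
  by_cases hj : j ∈ Set.range f
  · obtain ⟨i, rfl⟩ := hj
    rw [stdSimplex_map_apply_of_injective hf]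
    rfl
  · have h1 : t j = 0 := by
      by_contra h
      exact hj (ht h)
    rw [h1, stdSimplex_map_apply]
    refine Finset.sum_eq_zero fun i hi => absurd ⟨i, ?_⟩ hj
    simpa using hi

theorem support_stdSimplex_nonempty (t : stdSimplex ℝ ι) : (Function.support t).Nonempty := by
  by_contra h
  have h0 : ∀ i, t i = 0 := by
    simpa [Set.not_nonempty_iff_eq_empty, Function.support_eq_empty_iff, funext_iff] using h
  have := stdSimplex.sum_eq_one t
  simp [h0] at this

end Simplex

/-! ### Faces and interiors of standard simplices. -/

theorem notMem_simplexBoundary {n : ℕ} {t : stdSimplex ℝ (Fin (n + 1))} :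
    t ∉ simplexBoundary n ↔ Function.support t = Set.univ := by
  simp [simplexBoundary, Set.eq_univ_iff_forall]

theorem injective_toOrderHom {m n : SimplexCategory} (f : m ⟶ n) [Mono f] :
    Function.Injective f.toOrderHom :=
  SimplexCategory.mono_iff_injective.1 inferInstance

theorem surjective_toOrderHom {m n : SimplexCategory} (f : m ⟶ n) [Epi f] :
    Function.Surjective f.toOrderHom :=
  SimplexCategory.epi_iff_surjective.1 inferInstance

theorem map_notMem_simplexBoundary {m n : SimplexCategory} (f : m ⟶ n) [Epi f]
    {t : stdSimplex ℝ (Fin (m.len + 1))} (ht : t ∉ simplexBoundary m.len) :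
    stdSimplex.map f.toOrderHom t ∉ simplexBoundary n.len := by
  rw [notMem_simplexBoundary] at ht ⊢
  rw [support_stdSimplex_map, ht, Set.image_univ, (surjective_toOrderHom f).range_eq]

/-- Every nonempty set of vertices spans a face. -/
theorem exists_mono_range_eq {n : SimplexCategory} {S : Set (Fin (n.len + 1))} (hS : S.Nonempty) :
    ∃ (k : ℕ) (δ : ⦋k⦌ ⟶ n), Mono δ ∧ Set.range δ.toOrderHom = S := by
  classical
  obtain ⟨k, hk⟩ : ∃ k, S.toFinset.card = k + 1 :=
    Nat.exists_eq_succ_of_ne_zero (Finset.card_ne_zero.2 (by simpa using hS))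
  refine ⟨k, SimplexCategory.Hom.mk (S.toFinset.orderEmbOfFin hk).toOrderHom, ?_, ?_⟩
  · rw [SimplexCategory.mono_iff_injective]
    exact (S.toFinset.orderEmbOfFin hk).injective
  · exact (Finset.range_orderEmbOfFin _ hk).trans (by simp)

/-- A face is determined by its vertices. -/
theorem mono_eq_of_range_eq {n : SimplexCategory} {k l : ℕ} (δ : ⦋k⦌ ⟶ n) (ε : ⦋l⦌ ⟶ n) [Mono δ]
    [Mono ε] (h : Set.range δ.toOrderHom = Set.range ε.toOrderHom) :
    ∃ e : k = l, δ = eqToHom (by rw [e]) ≫ ε := by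
  classical
  have hk : k = l := by
    have := congrArg Set.ncard h
    rw [← Set.image_univ, ← Set.image_univ, Set.ncard_image_of_injective _ (injective_toOrderHom δ),
      Set.ncard_image_of_injective _ (injective_toOrderHom ε)] at this
    simpa using this
  subst hk
  refine ⟨rfl, ?_⟩
  rw [eqToHom_refl, Category.id_comp]
  apply SimplexCategory.Hom.ext
  apply OrderHom.ext
  exact ((δ.toOrderHom.monotone.strictMono_of_injective (injective_toOrderHom δ)).range_inj
    (ε.toOrderHom.monotone.strictMono_of_injective (injective_toOrderHom ε))).1 h

theorem stdSimplex_map_comp {l m n : SimplexCategory} (f : l ⟶ m) (g : m ⟶ n)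
    (t : stdSimplex ℝ (Fin (l.len + 1))) :
    stdSimplex.map (f ≫ g).toOrderHom t =
      stdSimplex.map g.toOrderHom (stdSimplex.map f.toOrderHom t) :=
  (stdSimplex.map_comp_apply (S := ℝ) f.toOrderHom g.toOrderHom t).symm

theorem stdSimplex_map_id {n : SimplexCategory} (t : stdSimplex ℝ (Fin (n.len + 1))) :
    stdSimplex.map (SimplexCategory.Hom.toOrderHom (𝟙 n)) t = t :=
  stdSimplex.map_id_apply t

/-- The face spanned by the support of `t` contains `t` in its interior. -/
theorem exists_eq_map_notMem_simplexBoundary {n : SimplexCategory}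
    (t : stdSimplex ℝ (Fin (n.len + 1))) : ∃ (k : ℕ) (δ : ⦋k⦌ ⟶ n) (_ : Mono δ)
      (s : stdSimplex ℝ (Fin (k + 1))), s ∉ simplexBoundary k ∧ stdSimplex.map δ.toOrderHom s = t := by
  obtain ⟨k, δ, _, hδ⟩ := exists_mono_range_eq (support_stdSimplex_nonempty t)
  obtain ⟨s, hs⟩ := exists_eq_stdSimplex_map (injective_toOrderHom δ) hδ.ge
  refine ⟨k, δ, ‹_›, s, ?_, hs⟩
  rw [notMem_simplexBoundary]
  rw [← hs, support_stdSimplex_map, ← Set.image_univ] at hδ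
  exact ((Set.image_injective.2 (injective_toOrderHom δ)) hδ).symm

/-- This recovers a face from any of its interior points, hence the uniqueness of the face carrying
a point. -/
theorem range_eq_support {n : SimplexCategory} {k : ℕ} (δ : ⦋k⦌ ⟶ n)
    {s : stdSimplex ℝ (Fin (k + 1))} (hs : s ∉ simplexBoundary k) :
    Set.range δ.toOrderHom = Function.support (stdSimplex.map δ.toOrderHom s) := by
  rw [notMem_simplexBoundary] at hs
  rw [support_stdSimplex_map]
  exact Set.image_univ.symm.trans (congrArg _ hs.symm)

/-! ### Normal forms of points of the realization -/

variable (X : SSet.{u})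

theorem tensor_map {n m : SimplexCategory} (α : n ⟶ m) (x : X.obj (op m))
    (t : stdSimplex ℝ (Fin (n.len + 1))) :
    tensor X (X.map α.op x) t = tensor X x (stdSimplex.map α.toOrderHom t) :=
  Quot.sound (RealizationRel.glue α x t)

theorem map_comp_op_apply {l m n : SimplexCategory} (f : l ⟶ m) (g : m ⟶ n) (x : X.obj (op n)) :
    X.map (f ≫ g).op x = X.map f.op (X.map g.op x) := by
  rw [op_comp, X.map_comp]
  rfl

/-- The pairs of a nondegenerate simplex and a point of the standard simplex of its dimension. -/
abbrev Cell : Type u := Σ k : ℕ, X.nonDegenerate k × stdSimplex ℝ (Fin (k + 1))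

/-- The relation between a representative `(x, t)` of a point of the realization and the unique
representative of the same point by a nondegenerate simplex and an interior point. -/
def IsNormalForm (p : (realizationSum X).carrier) (c : Cell X) : Prop :=
  ∃ (j : ℕ) (δ : ⦋j⦌ ⟶ p.1) (σ : ⦋j⦌ ⟶ ⦋c.1⦌) (s : stdSimplex ℝ (Fin (j + 1))), Mono δ ∧ Epi σ ∧
    s ∉ simplexBoundary j ∧ p.2.2 = stdSimplex.map δ.toOrderHom s ∧
    X.map δ.op p.2.1 = X.map σ.op c.2.1.1 ∧ c.2.2 = stdSimplex.map σ.toOrderHom s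

variable {X}

/-- The vertices of `δ` must be the support of the point, which fixes `δ` and then `s` by
injectivity. The remaining data are fixed by the uniqueness in the Eilenberg–Zilber lemma. -/
theorem IsNormalForm.unique {p : (realizationSum X).carrier} {c d : Cell X}
    (hc : IsNormalForm X p c) (hd : IsNormalForm X p d) : c = d := by
  obtain ⟨n, x, t⟩ := p
  obtain ⟨k, y, a⟩ := c
  obtain ⟨l, z, b⟩ := d
  obtain ⟨j, δ, σ, s, _, _, hs, ht, hx, ha⟩ := hc
  obtain ⟨j', δ', σ', s', _, _, hs', ht', hx', hb⟩ := hd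
  dsimp only at *
  obtain ⟨rfl, hδ⟩ := mono_eq_of_range_eq δ δ' (by
    rw [range_eq_support δ hs, range_eq_support δ' hs', ← ht, ← ht'])
  rw [eqToHom_refl, Category.id_comp] at hδ
  subst hδ
  obtain rfl : s = s' := stdSimplex_map_injective (injective_toOrderHom δ) (ht.symm.trans ht')
  obtain rfl := X.unique_nonDegenerate_dim _ σ y hx σ' z hx'
  obtain rfl := X.unique_nonDegenerate_simplex _ σ y hx σ' z hx'
  obtain rfl := X.unique_nonDegenerate_map _ σ y hx σ' y hx'
  rw [ha, hb]

theorem exists_isNormalForm (p : (realizationSum X).carrier) : ∃ c, IsNormalForm X p c := by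
  obtain ⟨n, x, t⟩ := p
  obtain ⟨j, δ, _, s, hs, rfl⟩ := exists_eq_map_notMem_simplexBoundary t
  obtain ⟨k, σ, _, y, hy⟩ := X.exists_nonDegenerate (X.map δ.op x)
  exact ⟨⟨k, y, stdSimplex.map σ.toOrderHom s⟩, j, δ, σ, s, ‹_›, ‹_›, hs, rfl, hy, rfl⟩

/-- Factor `δ ≫ α` as an epi `σ` followed by a mono `ε`. If the face of `x` along `ε` is the
degeneracy of `y` along `τ`, then `τ` normalises `(x, α_* t)`, and `σ ≫ τ` normalises `(α^* x, t)`
to the same cell. -/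
theorem exists_isNormalForm_of_rel {p q : (realizationSum X).carrier} (h : RealizationRel X p q) :
    ∃ c, IsNormalForm X p c ∧ IsNormalForm X q c := by
  obtain ⟨α, x, t⟩ := h
  rename_i n m
  obtain ⟨j, δ, _, s, hs, rfl⟩ := exists_eq_map_notMem_simplexBoundary t
  obtain ⟨i, hi⟩ : ∃ i, image (δ ≫ α) = ⦋i⦌ := ⟨_, (SimplexCategory.mk_len _).symm⟩
  obtain ⟨σ, ε, _, _, hα⟩ : ∃ (σ : ⦋j⦌ ⟶ ⦋i⦌) (ε : ⦋i⦌ ⟶ m), Epi σ ∧ Mono ε ∧ δ ≫ α = σ ≫ ε :=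
    ⟨factorThruImage (δ ≫ α) ≫ eqToHom hi, eqToHom hi.symm ≫ image.ι (δ ≫ α), inferInstance,
      inferInstance, by simp⟩
  obtain ⟨k, τ, _, y, hy⟩ := X.exists_nonDegenerate (X.map ε.op x)
  refine ⟨⟨k, y, stdSimplex.map τ.toOrderHom (stdSimplex.map σ.toOrderHom s)⟩,
    ⟨j, δ, σ ≫ τ, s, ‹_›, epi_comp _ _, hs, rfl, ?_, (stdSimplex_map_comp _ _ _).symm⟩,
    ⟨i, ε, τ, stdSimplex.map σ.toOrderHom s, ‹_›, ‹_›, map_notMem_simplexBoundary σ hs, ?_, hy,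
      rfl⟩⟩
  · change X.map δ.op (X.map α.op x) = _
    rw [← map_comp_op_apply, hα, map_comp_op_apply, map_comp_op_apply, ← hy]
  · change stdSimplex.map α.toOrderHom (stdSimplex.map δ.toOrderHom s) = _
    rw [← stdSimplex_map_comp, hα, stdSimplex_map_comp]
    rfl

/-- The normal form of a point of the realization. -/
noncomputable def normalForm (X : SSet.{u}) : (realization X).carrier → Cell X :=
  Quot.lift (fun p => (exists_isNormalForm p).choose) fun p q h => by
    obtain ⟨c, hp, hq⟩ := exists_isNormalForm_of_rel h
    exact ((exists_isNormalForm p).choose_spec.unique hp).trans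
      ((exists_isNormalForm q).choose_spec.unique hq).symm

theorem normalForm_tensor {k : ℕ} (y : X.nonDegenerate k) {s : stdSimplex ℝ (Fin (k + 1))}
    (hs : s ∉ simplexBoundary k) : normalForm X (tensor X (n := ⦋k⦌) y.1 s) = ⟨k, y, s⟩ :=
  (exists_isNormalForm _).choose_spec.unique ⟨k, 𝟙 ⦋k⦌, 𝟙 ⦋k⦌, s,
    (inferInstance : Mono (𝟙 ⦋k⦌)), (inferInstance : Epi (𝟙 ⦋k⦌)), hs,
    (stdSimplex_map_id (n := ⦋k⦌) s).symm, rfl, (stdSimplex_map_id (n := ⦋k⦌) s).symm⟩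

/-! ### Convergence in the realization -/

theorem tensor_conv {n : SimplexCategory} (x : X.obj (op n))
    {F : Filter (stdSimplex ℝ (Fin (n.len + 1)))} {t : stdSimplex ℝ (Fin (n.len + 1))}
    (h : F ≤ nhds t) : (realization X).Conv (F.map (tensor X x)) (tensor X x t) :=
  (coendι X n).cont (F.map (Sigma.mk x)) ⟨x, t⟩ ⟨F, h, le_rfl⟩

/-- An ultrafilter on a standard simplex is carried by the interior of one of its faces. -/
theorem exists_ultrafilter_map_face {n : SimplexCategory}
    {V : Ultrafilter (stdSimplex ℝ (Fin (n.len + 1)))} {t : stdSimplex ℝ (Fin (n.len + 1))}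
    (hV : (V : Filter (stdSimplex ℝ (Fin (n.len + 1)))) ≤ nhds t) :
    ∃ (k : ℕ) (δ : ⦋k⦌ ⟶ n) (W : Ultrafilter (stdSimplex ℝ (Fin (k + 1))))
      (s : stdSimplex ℝ (Fin (k + 1))),
      (W : Filter (stdSimplex ℝ (Fin (k + 1)))) ≤ nhds s ∧
      (∀ᶠ r in (W : Filter (stdSimplex ℝ (Fin (k + 1)))), r ∉ simplexBoundary k) ∧
      W.map (stdSimplex.map δ.toOrderHom) = V ∧ stdSimplex.map δ.toOrderHom s = t := by
  -- There are finitely many possible supports, so the support is constant along `V`.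
  obtain ⟨S, hS⟩ := Ultrafilter.eq_pure_of_finite
    (V.map fun r : stdSimplex ℝ (Fin (n.len + 1)) => Function.support r)
  have hmem : ∀ᶠ r : stdSimplex ℝ (Fin (n.len + 1)) in V, Function.support r = S := by
    have : {S} ∈ V.map fun r : stdSimplex ℝ (Fin (n.len + 1)) => Function.support r := by
      rw [hS]
      exact Set.mem_singleton S
    exact this
  obtain ⟨r₀, hr₀⟩ := hmem.exists
  obtain ⟨k, δ, _, hδ⟩ := exists_mono_range_eq (hr₀ ▸ support_stdSimplex_nonempty r₀)
  obtain ⟨W, -, hW⟩ := exists_ultrafilter_map_eq (U := V) (F := ⊤)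
    (stdSimplex.map (S := ℝ) δ.toOrderHom) (by
      rw [Filter.map_top, Filter.le_principal_iff]
      filter_upwards [hmem] with r hr
      exact exists_eq_stdSimplex_map (injective_toOrderHom δ) (by rw [hr, hδ]))
  -- Compactness of the face provides a limit of the lifted ultrafilter; below, uniqueness of limits
  -- identifies its image with `t`.
  obtain ⟨s, -, hs⟩ := isCompact_univ.ultrafilter_le_nhds W (by simp)
  refine ⟨k, δ, W, s, hs, ?_, hW, ?_⟩
  · subst hW
    filter_upwards [show ∀ᶠ r in (W : Filter (stdSimplex ℝ (Fin (k + 1)))),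
      Function.support (stdSimplex.map δ.toOrderHom r) = S from hmem] with r hr
    rw [notMem_simplexBoundary]
    rw [support_stdSimplex_map, ← hδ, ← Set.image_univ] at hr
    exact Set.image_injective.2 (injective_toOrderHom δ) hr
  · refine tendsto_nhds_unique (f := stdSimplex.map (S := ℝ) δ.toOrderHom)
      (((stdSimplex.continuous_map (S := ℝ) δ.toOrderHom).tendsto s).mono_left hs) ?_
    rw [← hW] at hV
    exact hV

/-- A convergent ultrafilter on the realization is the image of a convergent ultrafilter on a
nondegenerate simplex that is carried by the interior of this simplex. -/
theorem exists_nonDegenerate_of_conv {U : Ultrafilter (realization X).carrier}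
    {q : (realization X).carrier} (hU : (realization X).Conv U q) :
    ∃ (k : ℕ) (y : X.nonDegenerate k) (V : Ultrafilter (stdSimplex ℝ (Fin (k + 1))))
      (t : stdSimplex ℝ (Fin (k + 1))),
      (V : Filter (stdSimplex ℝ (Fin (k + 1)))) ≤ nhds t ∧
      (∀ᶠ s in (V : Filter (stdSimplex ℝ (Fin (k + 1)))), s ∉ simplexBoundary k) ∧
      V.map (tensor X (n := ⦋k⦌) y.1) = U ∧ tensor X (n := ⦋k⦌) y.1 t = q := by
  -- Convergence in the quotient, the outer coproduct and the copower is unfolded in turn; `H` is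
  -- the resulting filter on a single simplex.
  obtain ⟨V₀, ⟨n, x, t⟩, ⟨G, ⟨H, hH, hGH⟩, hG⟩, rfl, rfl⟩ := hU U le_rfl
  have hle := hG.trans (Filter.map_mono (m := Sigma.mk n) hGH)
  obtain ⟨V₁, hV₁, rfl⟩ := exists_ultrafilter_map_eq _ (hle.trans (Filter.map_map ..).le)
  obtain ⟨j, δ, W, s, hW, hWi, rfl, hst⟩ := exists_ultrafilter_map_face (hV₁.trans hH)
  obtain ⟨k, σ, _, y, hy⟩ := X.exists_nonDegenerate (X.map δ.op x)
  -- The face of `x` and the degeneracy of `y` are the same simplex, so the parametrisation by `x`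
  -- can be traded for the one by `y`.
  have key : ∀ r : stdSimplex ℝ (Fin (j + 1)),
      tensor X x (stdSimplex.map δ.toOrderHom r) =
        tensor X (n := ⦋k⦌) y.1 (stdSimplex.map σ.toOrderHom r) := fun r => by
    rw [← tensor_map, ← tensor_map, hy]
  refine ⟨k, y, W.map (stdSimplex.map σ.toOrderHom), stdSimplex.map σ.toOrderHom s, ?_, ?_, ?_,
    (key s).symm.trans (congrArg _ hst)⟩
  · exact ((stdSimplex.continuous_map (S := ℝ) σ.toOrderHom).tendsto s).mono_left hW
  · exact hWi.mono fun r hr => map_notMem_simplexBoundary σ hr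
  · ext A
    change {r | tensor X (n := ⦋k⦌) y.1 (stdSimplex.map σ.toOrderHom r) ∈ A} ∈ W ↔
      {r | tensor X x (stdSimplex.map δ.toOrderHom r) ∈ A} ∈ W
    simp only [key]

/-- A principal ultrafilter converges, so the description of convergent ultrafilters applies to it.
Almost every point of the lift is interior and represents `q`; the limit itself need not be
interior. -/
theorem exists_eq_tensor (q : (realization X).carrier) :
    ∃ (k : ℕ) (y : X.nonDegenerate k) (s : stdSimplex ℝ (Fin (k + 1))),
      s ∉ simplexBoundary k ∧ q = tensor X (n := ⦋k⦌) y.1 s := by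
  obtain ⟨k, y, V, t, -, hi, hV, -⟩ :=
    exists_nonDegenerate_of_conv (U := pure q) ((realization X).conv_pure q)
  have : ∀ᶠ s in (V : Filter (stdSimplex ℝ (Fin (k + 1)))), tensor X (n := ⦋k⦌) y.1 s = q := by
    have h : {q} ∈ V.map (tensor X (n := ⦋k⦌) y.1) := by
      rw [hV]
      exact Set.mem_singleton q
    exact h
  obtain ⟨s, hs, hq⟩ := (hi.and this).exists
  exact ⟨k, y, s, hs, hq.symm⟩

/-! ### Skeleta -/

theorem tensor_mem_skeleton {n k : ℕ} (h : k < n) (x : X _⦋k⦌) (t : stdSimplex ℝ (Fin (k + 1))) :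
    tensor X (n := ⦋k⦌) x t ∈ skeleton X n :=
  ⟨k, h, x, t, rfl⟩

theorem tensor_mem_skeleton_of_mem_simplexBoundary {n : ℕ} (x : X _⦋n⦌)
    {t : stdSimplex ℝ (Fin (n + 1))} (ht : t ∈ simplexBoundary n) :
    tensor X (n := ⦋n⦌) x t ∈ skeleton X n := by
  obtain ⟨k, δ, _, s, hs, rfl⟩ := exists_eq_map_notMem_simplexBoundary (n := ⦋n⦌) t
  rw [← tensor_map]
  refine tensor_mem_skeleton ((SimplexCategory.len_le_of_mono δ).lt_of_ne ?_) _ _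
  -- A face of full dimension is the identity, which would make `t` an interior point.
  rintro (rfl : k = n)
  rw [SimplexCategory.eq_id_of_mono δ, stdSimplex_map_id] at ht
  exact hs ht

/-- Normalising a representative of dimension `l` passes to a face and then undoes a degeneracy, so
the normal form has dimension at most `l`. -/
theorem lt_of_tensor_mem_skeleton {n k : ℕ} {y : X.nonDegenerate k} {s : stdSimplex ℝ (Fin (k + 1))}
    (hs : s ∉ simplexBoundary k) (h : tensor X (n := ⦋k⦌) y.1 s ∈ skeleton X n) : k < n := by
  obtain ⟨l, hl, x, t, ht⟩ := h
  obtain ⟨c, j, δ, σ, r, hδ, _, hr, h₁, h₂, h₃⟩ := exists_isNormalForm (realizationSum.mk X x t)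
  have e : normalForm X (tensor X x t) = c :=
    (exists_isNormalForm _).choose_spec.unique ⟨j, δ, σ, r, hδ, ‹_›, hr, h₁, h₂, h₃⟩
  rw [← ht, normalForm_tensor y hs] at e
  subst e
  have h1 : k ≤ j := SimplexCategory.len_le_of_epi σ
  have h2 : j ≤ l := @SimplexCategory.len_le_of_mono ⦋j⦌ ⦋l⦌ δ hδ
  omega


/-! ### Disks and simplices -/

/-- The simplex in `ℝ^n` spanned by the origin and the standard basis vectors. -/
def cornerSimplex (n : ℕ) : Set (EuclideanSpace ℝ (Fin n)) :=
  {v | (∀ i, 0 ≤ v i) ∧ ∑ i, v i ≤ 1}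

/-- Dropping the zeroth barycentric coordinate. -/
noncomputable def cornerHomeomorph (n : ℕ) : cornerSimplex n ≃ₜ stdSimplex ℝ (Fin (n + 1)) where
  toFun v := ⟨Fin.cons (1 - ∑ i, v.1 i) v.1, by
    constructor
    · intro i
      cases i using Fin.cases with
      | zero => exact sub_nonneg.2 v.2.2
      | succ i => exact v.2.1 i
    · simp [Fin.sum_univ_succ]⟩
  invFun t := ⟨WithLp.toLp 2 fun i => t i.succ, fun i => stdSimplex.zero_le t i.succ, by
    have h := stdSimplex.sum_eq_one t
    rw [Fin.sum_univ_succ] at h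
    have := stdSimplex.zero_le t 0
    change ∑ i : Fin n, t i.succ ≤ 1
    linarith⟩
  left_inv v := by
    ext i
    rfl
  right_inv t := by
    ext i
    refine Fin.cases ?_ (fun i => ?_) i
    · have h := stdSimplex.sum_eq_one t
      rw [Fin.sum_univ_succ] at h
      change 1 - ∑ i : Fin n, t i.succ = t 0
      linarith
    · rfl
  continuous_toFun := by
    refine Continuous.subtype_mk (continuous_pi (Fin.cases ?_ fun i => ?_)) _
    · simp only [Fin.cons_zero]
      fun_prop
    · simp only [Fin.cons_succ]
      fun_prop
  continuous_invFun := by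
    refine Continuous.subtype_mk ((PiLp.continuous_toLp 2 _).comp (continuous_pi fun i => ?_)) _
    exact (continuous_apply i.succ).comp continuous_subtype_val

theorem cornerHomeomorph_mem_simplexBoundary {n : ℕ} (v : cornerSimplex n) :
    cornerHomeomorph n v ∈ simplexBoundary n ↔ ∑ i, v.1 i = 1 ∨ ∃ i, v.1 i = 0 := by
  change (∃ i, (Fin.cons (1 - ∑ i, v.1 i) v.1 : Fin (n + 1) → ℝ) i = 0) ↔ _
  rw [Fin.exists_fin_succ]
  simp only [Fin.cons_zero, Fin.cons_succ, sub_eq_zero, eq_comm (a := (1 : ℝ))]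

theorem convex_cornerSimplex (n : ℕ) : Convex ℝ (cornerSimplex n) := by
  rintro v ⟨hv, hv'⟩ w ⟨hw, hw'⟩ a b ha hb hab
  refine ⟨fun i => ?_, ?_⟩
  · have := mul_nonneg ha (hv i)
    have := mul_nonneg hb (hw i)
    simp only [PiLp.add_apply, PiLp.smul_apply, smul_eq_mul]
    linarith
  · simp only [PiLp.add_apply, PiLp.smul_apply, smul_eq_mul, Finset.sum_add_distrib,
      ← Finset.mul_sum]
    calc _ ≤ a * 1 + b * 1 := by gcongr
      _ = 1 := by linarith

theorem isCompact_cornerSimplex (n : ℕ) : IsCompact (cornerSimplex n) := by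
  have : CompactSpace (cornerSimplex n) := (cornerHomeomorph n).symm.compactSpace
  exact isCompact_iff_compactSpace.2 this

/-- From an interior point one can move slightly in any direction without leaving the simplex.
Moving along the negative of a basis vector excludes a zero coordinate; moving radially outward
along `v` itself excludes coordinate sum 1. -/
theorem interior_cornerSimplex (n : ℕ) :
    interior (cornerSimplex n) = {v | (∀ i, 0 < v i) ∧ ∑ i, v i < 1} := by
  apply subset_antisymm
  · intro v hv
    have hvK := interior_subset hv
    have key : ∀ w : EuclideanSpace ℝ (Fin n), ∃ r : ℝ, 0 < r ∧ v + r • w ∈ cornerSimplex n := by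
      intro w
      have hc : ContinuousAt (fun r : ℝ => v + r • w) 0 := by fun_prop
      have h0 : ∀ᶠ r in nhds (0 : ℝ), v + r • w ∈ cornerSimplex n :=
        hc.eventually_mem (by simpa using mem_interior_iff_mem_nhds.1 hv)
      obtain ⟨r, hr, hr0⟩ :=
        ((h0.filter_mono nhdsWithin_le_nhds).and (self_mem_nhdsWithin (s := Set.Ioi (0 : ℝ)))).exists
      exact ⟨r, hr0, hr⟩
    refine ⟨fun i => (hvK.1 i).lt_of_ne fun hi => ?_, hvK.2.lt_of_ne fun hs => ?_⟩
    · obtain ⟨r, hr, hw⟩ := key (EuclideanSpace.single i (-1))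
      have := hw.1 i
      simp [← hi] at this
      linarith
    · obtain ⟨r, hr, hw⟩ := key v
      have := hw.2
      simp only [PiLp.add_apply, PiLp.smul_apply, smul_eq_mul, Finset.sum_add_distrib,
        ← Finset.mul_sum, hs] at this
      linarith
  · refine interior_maximal (fun v hv => ⟨fun i => (hv.1 i).le, hv.2.le⟩) ?_
    have h₁ : IsOpen (⋂ i, {v | 0 < (v : EuclideanSpace ℝ (Fin n)) i}) :=
      isOpen_iInter_of_finite fun i => isOpen_lt continuous_const (by fun_prop)
    have h₂ : IsOpen {v | ∑ i, (v : EuclideanSpace ℝ (Fin n)) i < 1} :=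
      isOpen_lt (by fun_prop) continuous_const
    convert h₁.inter h₂ using 1
    ext v
    simp

/-- The corner simplex is a bounded closed convex set with nonempty interior in ℝ^n, so a
homeomorphism of ℝ^n takes it to the unit ball and its frontier to the sphere. -/
theorem exists_homeomorph_disk_stdSimplex (n : ℕ) :
    ∃ h : Disk n ≃ₜ stdSimplex ℝ (Fin (n + 1)), ∀ d : Disk n,
      (d : EuclideanSpace ℝ (Fin n)) ∈ Metric.sphere (0 : EuclideanSpace ℝ (Fin n)) 1 ↔
        h d ∈ simplexBoundary n := by
  have hne : (interior (cornerSimplex n)).Nonempty := by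
    -- This is the barycentre; its coordinate sum is n/(n+1).
    refine ⟨WithLp.toLp 2 fun _ => 1 / (n + 1 : ℝ), ?_⟩
    rw [interior_cornerSimplex]
    refine ⟨fun i => ?_, ?_⟩
    · change 0 < 1 / (n + 1 : ℝ)
      positivity
    · change ∑ _ : Fin n, 1 / (n + 1 : ℝ) < 1
      rw [Finset.sum_const, Finset.card_univ, Fintype.card_fin, nsmul_eq_mul, mul_one_div,
        div_lt_one (by positivity)]
      linarith
  obtain ⟨φ, -, h₁, h₂⟩ := exists_homeomorph_image_interior_closure_frontier_eq_unitBall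
    (convex_cornerSimplex n) hne (isCompact_cornerSimplex n).isBounded
  rw [(isCompact_cornerSimplex n).isClosed.closure_eq] at h₁
  rw [(isCompact_cornerSimplex n).isClosed.frontier_eq] at h₂
  have hK : ∀ d : EuclideanSpace ℝ (Fin n),
      d ∈ Metric.closedBall (0 : EuclideanSpace ℝ (Fin n)) 1 ↔ φ.symm d ∈ cornerSimplex n := by
    intro d
    rw [← h₁, φ.image_eq_preimage_symm]
    rfl
  refine ⟨(φ.symm.subtype hK).trans (cornerHomeomorph n), fun d => ?_⟩
  rw [Homeomorph.trans_apply, cornerHomeomorph_mem_simplexBoundary, ← h₂,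
    φ.image_eq_preimage_symm, interior_cornerSimplex]
  change φ.symm d ∈ cornerSimplex n ∧ ¬ ((∀ i, 0 < φ.symm d i) ∧ ∑ i, φ.symm d i < 1) ↔
    ∑ i, φ.symm d i = 1 ∨ ∃ i, φ.symm d i = 0
  have hd := (hK d).1 d.2
  rw [not_and_or, not_forall, and_iff_right hd, or_comm]
  refine or_congr ?_ (exists_congr fun i => ?_)
  · exact ⟨fun h => hd.2.antisymm (not_lt.1 h), fun h => by simp [h]⟩
  · exact ⟨fun h => (not_lt.1 h).antisymm (hd.1 i), fun h => by simp [h]⟩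

/-! ### Pushouts and direct limits of skeleta -/

variable {X : SSet.{u}}

theorem tensor_injective {k : ℕ} {y z : X.nonDegenerate k} {s t : stdSimplex ℝ (Fin (k + 1))}
    (hs : s ∉ simplexBoundary k) (ht : t ∉ simplexBoundary k)
    (h : tensor X (n := ⦋k⦌) y.1 s = tensor X (n := ⦋k⦌) z.1 t) : y = z ∧ s = t := by
  have := congrArg (normalForm X) h
  rw [normalForm_tensor y hs, normalForm_tensor z ht] at this
  simpa using this

/-- The points added by one skeleton to the previous one lie in open `n`-cells: the normal form has
dimension at most `n`, and a smaller dimension would put the point in the previous skeleton. -/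
theorem exists_eq_tensor_of_mem_skeleton_succ {n : ℕ} {q : (realization X).carrier}
    (hq : q ∈ skeleton X (n + 1)) (hq' : q ∉ skeleton X n) :
    ∃ p : X.nonDegenerate n × stdSimplex ℝ (Fin (n + 1)),
      p.2 ∉ simplexBoundary n ∧ q = tensor X (n := ⦋n⦌) p.1.1 p.2 := by
  obtain ⟨k, y, s, hs, rfl⟩ := exists_eq_tensor q
  obtain h | rfl := Nat.lt_succ_iff_lt_or_eq.1 (lt_of_tensor_mem_skeleton hs hq)
  · exact absurd (tensor_mem_skeleton h _ _) hq'
  · exact ⟨⟨y, s⟩, hs, rfl⟩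

theorem exists_mem_skeleton (q : (realization X).carrier) : ∃ n, q ∈ skeleton X n := by
  obtain ⟨k, y, s, -, rfl⟩ := exists_eq_tensor q
  exact ⟨k + 1, tensor_mem_skeleton k.lt_succ_self _ _⟩

/-- Continuity of a map on a skeleton can be checked on nondegenerate simplices. -/
theorem continuous_skeleton {n : ℕ} {Z : PsTop.{v}} (l : skeleton X n → Z.carrier)
    (hl : ∀ (k : ℕ) (hk : k < n) (y : X.nonDegenerate k)
      (F : Filter (stdSimplex ℝ (Fin (k + 1)))) (t : stdSimplex ℝ (Fin (k + 1))), F ≤ nhds t →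
      Z.Conv (F.map fun s => l ⟨tensor X (n := ⦋k⦌) y.1 s, tensor_mem_skeleton hk _ _⟩)
        (l ⟨tensor X (n := ⦋k⦌) y.1 t, tensor_mem_skeleton hk _ _⟩))
    (F : Filter (skeleton X n)) (q : skeleton X n)
    (hF : (sub (realization X) (skeleton X n)).Conv F q) :
    Z.Conv (F.map l) (l q) := by
  refine Z.conv_of_ultrafilter fun W hW => ?_
  obtain ⟨U, hU, rfl⟩ := exists_ultrafilter_map_eq _ hW
  have hUq : (realization X).Conv (U.map Subtype.val : Ultrafilter (realization X).carrier) q.1 :=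
    (realization X).conv_mono hF (Filter.map_mono hU)
  obtain ⟨k, y, V, t, hVt, hVi, hVU, htq⟩ := exists_nonDegenerate_of_conv hUq
  have hmem : ∀ᶠ s : stdSimplex ℝ (Fin (k + 1)) in V,
      tensor X (n := ⦋k⦌) y.1 s ∈ skeleton X n := by
    have : skeleton X n ∈ V.map (tensor X (n := ⦋k⦌) y.1) := by
      rw [hVU]
      exact Filter.Eventually.of_forall (f := (U : Filter (skeleton X n))) fun r => r.2
    exact this
  -- One interior point that lands in the skeleton is enough to bound the dimension of the whole
  -- simplex.
  obtain ⟨s, hs, hs'⟩ := (hVi.and hmem).exists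
  have hk := lt_of_tensor_mem_skeleton hs hs'
  obtain rfl : U = V.map fun s =>
      (⟨tensor X (n := ⦋k⦌) y.1 s, tensor_mem_skeleton hk _ _⟩ : skeleton X n) := by
    apply Ultrafilter.coe_injective
    apply Filter.map_injective Subtype.val_injective
    exact (congrArg Ultrafilter.toFilter hVU).symm
  obtain rfl : q = ⟨tensor X (n := ⦋k⦌) y.1 t, tensor_mem_skeleton hk _ _⟩ := Subtype.ext htq.symm
  exact hl k hk y V t hVt

/-- The map is `f` on the old skeleton and `g` on the open cells. The agreement on boundaries makes
it equal to `g` on closed cells, so its continuity on each nondegenerate simplex comes from `f`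
below dimension `n` and from `g` in dimension `n`. -/
theorem exists_skeleton_glue {n : ℕ} {Z : PsTop.{u}} (f : sub (realization X) (skeleton X n) ⟶ Z)
    (g : copower (X.nonDegenerate n) (ofTop (stdSimplex ℝ (Fin (n + 1)))) ⟶ Z)
    (hfg : ∀ (y : X.nonDegenerate n) (t : stdSimplex ℝ (Fin (n + 1))) (ht : t ∈ simplexBoundary n),
      f.toFun ⟨tensor X (n := ⦋n⦌) y.1 t, tensor_mem_skeleton_of_mem_simplexBoundary _ ht⟩ =
        g.toFun ⟨y, t⟩) :
    ∃ l : sub (realization X) (skeleton X (n + 1)) ⟶ Z,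
      (∀ q : skeleton X n, l.toFun ⟨q.1, monotone_skeleton X n.le_succ q.2⟩ = f.toFun q) ∧
      ∀ (y : X.nonDegenerate n) (t : stdSimplex ℝ (Fin (n + 1))),
        l.toFun ⟨tensor X (n := ⦋n⦌) y.1 t, tensor_mem_skeleton n.lt_succ_self _ _⟩ =
          g.toFun ⟨y, t⟩ := by
  classical
  let l : skeleton X (n + 1) → Z.carrier := fun q =>
    if h : q.1 ∈ skeleton X n then f.toFun ⟨q.1, h⟩ else
      g.toFun ⟨(exists_eq_tensor_of_mem_skeleton_succ q.2 h).choose.1,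
        (exists_eq_tensor_of_mem_skeleton_succ q.2 h).choose.2⟩
  have hlf : ∀ q : skeleton X n, l ⟨q.1, monotone_skeleton X n.le_succ q.2⟩ = f.toFun q :=
    fun q => dif_pos q.2
  have hlg : ∀ (y : X.nonDegenerate n) (t : stdSimplex ℝ (Fin (n + 1))),
      l ⟨tensor X (n := ⦋n⦌) y.1 t, tensor_mem_skeleton n.lt_succ_self _ _⟩ =
        g.toFun ⟨y, t⟩ := by
    intro y t
    by_cases h : tensor X (n := ⦋n⦌) y.1 t ∈ skeleton X n
    · have ht : t ∈ simplexBoundary n := by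
        by_contra ht
        exact (lt_of_tensor_mem_skeleton ht h).false
      exact (dif_pos h).trans (hfg y t ht)
    · have ht : t ∉ simplexBoundary n := fun ht =>
        h (tensor_mem_skeleton_of_mem_simplexBoundary _ ht)
      -- The chosen representative is interior, hence by uniqueness of normal forms it is `(y, t)`.
      obtain ⟨hs, he⟩ := (exists_eq_tensor_of_mem_skeleton_succ
        (tensor_mem_skeleton n.lt_succ_self y.1 t) h).choose_spec
      obtain ⟨h₁, h₂⟩ := tensor_injective ht hs he
      refine (dif_neg h).trans ?_
      rw [← h₁, ← h₂]
  refine ⟨⟨l, continuous_skeleton l fun k hk y F t hF => ?_⟩, hlf, hlg⟩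
  obtain hk' | rfl := Nat.lt_succ_iff_lt_or_eq.1 hk
  · have e : ∀ s, l ⟨tensor X (n := ⦋k⦌) y.1 s, tensor_mem_skeleton hk _ _⟩ =
        f.toFun ⟨tensor X (n := ⦋k⦌) y.1 s, tensor_mem_skeleton hk' _ _⟩ := fun s => hlf ⟨_, _⟩
    simp only [e]
    exact f.cont (F.map fun s => ⟨tensor X (n := ⦋k⦌) y.1 s, tensor_mem_skeleton hk' _ _⟩) _
      (tensor_conv (n := ⦋k⦌) y.1 hF)
  · simp only [hlg]
    exact g.cont (F.map (Sigma.mk y)) ⟨y, t⟩ ⟨F, hF, le_rfl⟩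

variable (X)

/-- The attaching maps of the cells of the realization. -/
noncomputable def attachMap (n : ℕ) :
    copower (X.nonDegenerate n) (ofTop (simplexBoundary n)) ⟶
      sub (realization X) (skeleton X n) where
  toFun p := ⟨tensor X (n := ⦋n⦌) p.1.1 p.2.1,
    tensor_mem_skeleton_of_mem_simplexBoundary _ p.2.2⟩
  cont := (continuous_sigma_iff (Y := fun _ : X.nonDegenerate n => ofTop (simplexBoundary n))
    (Z := sub (realization X) (skeleton X n)) _).2 fun y _ t hF =>
      tensor_conv (n := ⦋n⦌) y.1 ((boundaryIncl n).cont _ t hF)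

/-- The characteristic maps of the cells of the realization. -/
noncomputable def characteristicMap (n : ℕ) :
    copower (X.nonDegenerate n) (ofTop (stdSimplex ℝ (Fin (n + 1)))) ⟶
      sub (realization X) (skeleton X (n + 1)) where
  toFun p := ⟨tensor X (n := ⦋n⦌) p.1.1 p.2, tensor_mem_skeleton n.lt_succ_self _ _⟩
  cont := (continuous_sigma_iff
    (Y := fun _ : X.nonDegenerate n => ofTop (stdSimplex ℝ (Fin (n + 1))))
    (Z := sub (realization X) (skeleton X (n + 1))) _).2 fun y _ _ hF =>
      tensor_conv (n := ⦋n⦌) y.1 hF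

/-- Existence is the gluing of maps; uniqueness holds since the old skeleton and the cells together
cover the new skeleton. -/
theorem isPushout_skeleton (n : ℕ) :
    IsPushout (attachMap X n) (copowerMap id (boundaryIncl n))
      (subIncl (realization X) (monotone_skeleton X n.le_succ)) (characteristicMap X n) := by
  have glue := fun s : PushoutCocone (attachMap X n) (copowerMap id (boundaryIncl n)) =>
    exists_skeleton_glue s.inl s.inr fun y t ht =>
      congrFun (congrArg Hom.toFun s.condition) ⟨y, ⟨t, ht⟩⟩
  refine IsPushout.of_isColimit' ⟨rfl⟩ (PushoutCocone.IsColimit.mk _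
    (fun s => (glue s).choose) ?_ ?_ ?_)
  · intro s
    apply hom_ext
    funext q
    exact (glue s).choose_spec.1 q
  · intro s
    apply hom_ext
    funext p
    exact (glue s).choose_spec.2 p.1 p.2
  · intro s m h₁ h₂
    apply hom_ext
    funext ⟨q, hq⟩
    by_cases h : q ∈ skeleton X n
    · exact (congrFun (congrArg Hom.toFun h₁) ⟨q, h⟩).trans
        ((glue s).choose_spec.1 ⟨q, h⟩).symm
    · obtain ⟨⟨y, t⟩, -, rfl⟩ := exists_eq_tensor_of_mem_skeleton_succ hq h
      exact (congrFun (congrArg Hom.toFun h₂) ⟨y, t⟩).trans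
        ((glue s).choose_spec.2 y t).symm

theorem nonempty_isColimit_skeleton :
    Nonempty (IsColimit (filtrationCocone (realization X) (skeleton X) (monotone_skeleton X))) := by
  have compat : ∀ (s : Cocone (filtration (realization X) (skeleton X) (monotone_skeleton X)))
      {m n : ℕ} {q : (realization X).carrier} (hm : q ∈ skeleton X m) (hn : q ∈ skeleton X n),
      (s.ι.app m).toFun ⟨q, hm⟩ = (s.ι.app n).toFun ⟨q, hn⟩ := by
    intro s
    have h : ∀ {m n : ℕ} {q : (realization X).carrier} (hm : q ∈ skeleton X m)
        (hn : q ∈ skeleton X n), m ≤ n →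
        (s.ι.app m).toFun ⟨q, hm⟩ = (s.ι.app n).toFun ⟨q, hn⟩ := fun hm _ hmn =>
      (congrFun (congrArg Hom.toFun (s.w (homOfLE hmn))) ⟨_, hm⟩).symm
    intro m n q hm hn
    obtain hmn | hmn := le_total m n
    · exact h hm hn hmn
    · exact (h hn hm hmn).symm
  refine ⟨{
    -- Any skeleton containing `q` may be chosen, since `compat` makes the value independent of it.
    desc := fun s => ⟨fun q => (s.ι.app (exists_mem_skeleton q).choose).toFun
      ⟨q, (exists_mem_skeleton q).choose_spec⟩, fun F q hF => ?_⟩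
    fac := fun s n => ?_
    uniq := fun s m hm => ?_ }⟩
  · refine s.pt.conv_of_ultrafilter fun W hW => ?_
    obtain ⟨U, hU, rfl⟩ := exists_ultrafilter_map_eq _ hW
    -- The ultrafilter and its limit come from one `k`-simplex, so both live in `skeleton X (k +
    -- 1)`, where the cocone map is continuous.
    obtain ⟨k, y, V, t, hVt, -, rfl, rfl⟩ :=
      exists_nonDegenerate_of_conv ((realization X).conv_mono hF hU)
    have hk : ∀ r, tensor X (n := ⦋k⦌) y.1 r ∈ skeleton X (k + 1) :=
      tensor_mem_skeleton k.lt_succ_self y.1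
    have hc := (s.ι.app (k + 1)).cont ((V : Filter (stdSimplex ℝ (Fin (k + 1)))).map
      fun r => ⟨tensor X (n := ⦋k⦌) y.1 r, hk r⟩) ⟨_, hk t⟩ (tensor_conv (n := ⦋k⦌) y.1 hVt)
    rw [compat s _ (hk t)]
    have e : (fun r => (s.ι.app (exists_mem_skeleton (tensor X (n := ⦋k⦌) y.1 r)).choose).toFun
        ⟨_, (exists_mem_skeleton (tensor X (n := ⦋k⦌) y.1 r)).choose_spec⟩) =
        fun r => (s.ι.app (k + 1)).toFun ⟨_, hk r⟩ := funext fun r => compat s _ (hk r)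
    change s.pt.Conv ((V : Filter (stdSimplex ℝ (Fin (k + 1)))).map fun r =>
      (s.ι.app (exists_mem_skeleton (tensor X (n := ⦋k⦌) y.1 r)).choose).toFun
        ⟨_, (exists_mem_skeleton (tensor X (n := ⦋k⦌) y.1 r)).choose_spec⟩) _
    rw [e]
    exact hc
  · apply hom_ext
    funext q
    exact compat s _ q.2
  · apply hom_ext
    funext q
    exact congrFun (congrArg Hom.toFun (hm _)) ⟨q, (exists_mem_skeleton q).choose_spec⟩

/-! ### The CW structure -/

/-- Homeomorphic topological spaces are isomorphic as pseudotopological spaces. -/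
def isoOfHomeomorph {S T : Type u} [TopologicalSpace S] [TopologicalSpace T] (e : S ≃ₜ T) :
    ofTop S ≅ ofTop T where
  hom := ofTopMap e e.continuous
  inv := ofTopMap e.symm e.symm.continuous
  hom_inv_id := hom_ext (funext e.symm_apply_apply)
  inv_hom_id := hom_ext (funext e.apply_symm_apply)

/-- Copowers preserve isomorphisms. -/
def copowerIso (I : Type u) {Y Z : PsTop.{0}} (e : Y ≅ Z) : copower I Y ≅ copower I Z where
  hom := copowerMap id e.hom
  inv := copowerMap id e.inv
  hom_inv_id := hom_ext (funext fun p => congrArg (Sigma.mk (β := fun _ : I => Y.carrier) p.1)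
    (congrFun (congrArg Hom.toFun e.hom_inv_id) p.2))
  inv_hom_id := hom_ext (funext fun p => congrArg (Sigma.mk (β := fun _ : I => Z.carrier) p.1)
    (congrFun (congrArg Hom.toFun e.inv_hom_id) p.2))

/-- A homeomorphism of the disk onto the simplex. -/
noncomputable def diskHomeomorph (n : ℕ) : Disk n ≃ₜ stdSimplex ℝ (Fin (n + 1)) :=
  (exists_homeomorph_disk_stdSimplex n).choose

theorem diskHomeomorph_mem_iff {n : ℕ} (d : Disk n) :
    (d : EuclideanSpace ℝ (Fin n)) ∈ Metric.sphere (0 : EuclideanSpace ℝ (Fin n)) 1 ↔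
      diskHomeomorph n d ∈ simplexBoundary n :=
  (exists_homeomorph_disk_stdSimplex n).choose_spec d

/-- The induced homeomorphism of the sphere onto the boundary of the simplex. -/
noncomputable def sphereHomeomorph (n : ℕ) : BdSphere n ≃ₜ simplexBoundary n where
  toFun d := ⟨diskHomeomorph n (Set.inclusion Metric.sphere_subset_closedBall d),
    (diskHomeomorph_mem_iff _).1 d.2⟩
  invFun t := ⟨(diskHomeomorph n).symm t.1, (diskHomeomorph_mem_iff _).2 (by simp)⟩
  left_inv d := by
    ext1
    exact congrArg (Subtype.val : Disk n → EuclideanSpace ℝ (Fin n))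
      ((diskHomeomorph n).symm_apply_apply (Set.inclusion Metric.sphere_subset_closedBall d))
  right_inv t := by
    ext1
    exact (diskHomeomorph n).apply_symm_apply _
  continuous_toFun := ((diskHomeomorph n).continuous.comp (continuous_inclusion _)).subtype_mk _
  continuous_invFun := (continuous_subtype_val.comp
    ((diskHomeomorph n).symm.continuous.comp continuous_subtype_val)).subtype_mk _

/-- The CW structure of the realization of a simplicial set. -/
noncomputable def realizationCW : CWStructure (realization X) where
  sk := skeleton X
  sk_zero := by
    ext q
    simp [skeleton]
  monotone_sk := monotone_skeleton X
  isColimit := nonempty_isColimit_skeleton X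
  cells n := X.nonDegenerate n
  attach n := copowerMap id (isoOfHomeomorph (sphereHomeomorph n)).hom ≫ attachMap X n
  charMap n := copowerMap id (isoOfHomeomorph (diskHomeomorph n)).hom ≫ characteristicMap X n
  -- The sphere homeomorphism is a restriction of the disk homeomorphism, so the simplicial square
  -- transports to disks and all comparison squares commute definitionally.
  isPushout n := IsPushout.of_iso' (isPushout_skeleton X n)
    (copowerIso _ (isoOfHomeomorph (sphereHomeomorph n))) (Iso.refl _)
    (copowerIso _ (isoOfHomeomorph (diskHomeomorph n))) (Iso.refl _) rfl rfl rfl rfl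

end PsTop

theorem mainTheorem6 (X : SSet.{u}) :
    PsTop.IsCWComplex (PsTop.realization X) ∧
    (∃ C : PsTop.CWStructure (PsTop.realization X),
      (∀ n : ℕ, C.sk n = PsTop.skeleton X n) ∧
      ∀ n : ℕ, ∃ (e : C.cells n ≃ X.nonDegenerate n)
        (h : PsTop.Disk n ≃ₜ stdSimplex ℝ (Fin (n + 1))),
        (∀ d : PsTop.Disk n,
          (d : EuclideanSpace ℝ (Fin n)) ∈ Metric.sphere (0 : EuclideanSpace ℝ (Fin n)) 1 ↔
            h d ∈ PsTop.simplexBoundary n) ∧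
        ∀ (c : C.cells n) (d : PsTop.Disk n),
          ((C.charMap n).toFun ⟨c, d⟩).1 = PsTop.tensor X (n := ⦋n⦌) (e c).1 (h d)) ∧
    ∀ n : ℕ, ∃
      (a : PsTop.copower (X.nonDegenerate n) (PsTop.ofTop (PsTop.simplexBoundary n)) ⟶
        PsTop.sub (PsTop.realization X) (PsTop.skeleton X n))
      (b : PsTop.copower (X.nonDegenerate n) (PsTop.ofTop (stdSimplex ℝ (Fin (n + 1)))) ⟶
        PsTop.sub (PsTop.realization X) (PsTop.skeleton X (n + 1))),
      (∀ (x : X.nonDegenerate n) (t : PsTop.simplexBoundary n),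
        (a.toFun ⟨x, t⟩).1 = PsTop.tensor X (n := ⦋n⦌) x.1 t.1) ∧
      (∀ (x : X.nonDegenerate n) (t : stdSimplex ℝ (Fin (n + 1))),
        (b.toFun ⟨x, t⟩).1 = PsTop.tensor X (n := ⦋n⦌) x.1 t) ∧
      IsPushout a (PsTop.copowerMap id (PsTop.boundaryIncl n))
        (PsTop.subIncl (PsTop.realization X) (PsTop.monotone_skeleton X n.le_succ)) b :=
  ⟨⟨PsTop.realizationCW X⟩,
    ⟨PsTop.realizationCW X, fun _ => rfl, fun n =>
      ⟨Equiv.refl _, PsTop.diskHomeomorph n, PsTop.diskHomeomorph_mem_iff, fun _ _ => rfl⟩⟩,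
    fun n => ⟨PsTop.attachMap X n, PsTop.characteristicMap X n, fun _ _ => rfl, fun _ _ => rfl,
      PsTop.isPushout_skeleton X n⟩⟩
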